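/- Fix the types generated by the grammar $T ::= \mathcal U \mid \mathrm{Unit} \mid T\times T \mid \mathrm{Set}(T)$. Over a set $\mathcal U$ of Ur-elements (possibly empty, finite or infinite), the objects of type $\mathcal U$ are the elements of $\mathcal U$, the type $\mathrm{Unit}$ has exactly one object, the objects of type $T_1\times T_2$ are the pairs of objects of types $T_1$ and $T_2$, and the objects of type $\mathrm{Set}(T)$ are all (finite or infinite) sets of objects of type $T$. Terms are the well-typed expressions built from typed variables by $t ::= x \mid () \mid \langle t,t\rangle \mid \pi_1(t)\mid \pi_2(t)$, and $\Delta_0$ formulas are the well-typed expressions $$\varphi ::= t=_{\mathcal U}t' \mid t\neq_{\mathcal U}t' \mid \top\mid\bot\mid \varphi\vee\varphi\mid\varphi\wedge\varphi\mid \forall x\in_T t\;\varphi\mid\exists x\in_T t\;\varphi$$ with the usual semantics under bindings of the free variables to objects over $\mathcal U$. A $\Delta_0$ formula $\Sigma(o_{in},o_{out},\vec a)$, where $\vec a$ is a (possibly empty) finite list of variables, \emph{implicitly defines $o_{out}$ as a function of $o_{in}$} if, over every set $\mathcal U$ of Ur-elements, any two bindings of the variables $o_{in},o_{out},\vec a$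 that satisfy $\Sigma$ and agree on $o_{in}$ also agree on $o_{out}$. Lemma. Let $o_{in}$, $o_{out}$, $\vec a$ be variables of arbitrary types and let $\Sigma(o_{in},o_{out},\vec a)$ be a $\Delta_0$ formula that implicitly defines $o_{out}$ as a function of $o_{in}$. Then there is a $\Delta_0$ formula $\Sigma'(o_{in},o_{out})$, with no free variables other than $o_{in}$ and $o_{out}$, that also implicitly defines $o_{out}$ as a function of $o_{in}$ and such that $\Sigma(o_{in},o_{out},\vec a)\Rightarrow\Sigma'(o_{in},o_{out})$ holds over every set of Ur-elements and for all bindings of $o_{in},o_{out},\vec a$. -/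

import Mathlib

universe u

namespace NestedRel

/-- Types of nested relations: Ur-elements, the one-element type, products and sets. -/
inductive Ty : Type
  | ur : Ty
  | unit : Ty
  | prod : Ty → Ty → Ty
  | set : Ty → Ty

/-- The objects of each type in the universe over a set `U` of Ur-elements. The set type
contains all sets of objects, finite or infinite. -/
def Ty.Obj (U : Type u) : Ty → Type u
  | .ur => U
  | .unit => PUnit
  | .prod S T => S.Obj U × T.Obj U
  | .set T => Set (T.Obj U)

/-- A schema: a finite list of typed variables, which are referred to by their position. -/
abbrev Ctx : Type := List Ty

/-- `Var Γ T` is the type of the variables of type `T` declared in `Γ`. -/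
inductive Var : Ctx → Ty → Type
  | here {Γ : Ctx} {T : Ty} : Var (T :: Γ) T
  | there {Γ : Ctx} {S T : Ty} : Var Γ T → Var (S :: Γ) T

/-- Well-typed terms, built from variables, the unit element, pairing and projections. -/
inductive Term (Γ : Ctx) : Ty → Type
  | var {T : Ty} : Var Γ T → Term Γ T
  | star : Term Γ .unit
  | pair {S T : Ty} : Term Γ S → Term Γ T → Term Γ (.prod S T)
  | fst {S T : Ty} : Term Γ (.prod S T) → Term Γ S
  | snd {S T : Ty} : Term Γ (.prod S T) → Term Γ T

/-- Well-typed `Δ₀` formulas whose free variables are declared in `Γ`. The only atomic formulas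
are equalities and inequalities of Ur-elements; `all t φ` is `∀ x ∈ t, φ` and `ex t φ` is
`∃ x ∈ t, φ`, where `x` is the first variable of the extended context and does not occur
in `t`. -/
inductive Formula : Ctx → Type
  | eq {Γ : Ctx} : Term Γ .ur → Term Γ .ur → Formula Γ
  | ne {Γ : Ctx} : Term Γ .ur → Term Γ .ur → Formula Γ
  | top {Γ : Ctx} : Formula Γ
  | bot {Γ : Ctx} : Formula Γ
  | or {Γ : Ctx} : Formula Γ → Formula Γ → Formula Γ
  | and {Γ : Ctx} : Formula Γ → Formula Γ → Formula Γ
  | all {Γ : Ctx} {T : Ty} : Term Γ (.set T) → Formula (T :: Γ) → Formula Γ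
  | ex {Γ : Ctx} {T : Ty} : Term Γ (.set T) → Formula (T :: Γ) → Formula Γ

/-- Bindings of the variables of a context to objects over `U`. -/
def Env (U : Type u) : Ctx → Type u
  | [] => PUnit
  | T :: Γ => T.Obj U × Env U Γ

/-- The value of a variable under a binding. -/
def Var.eval {U : Type u} : {Γ : Ctx} → {T : Ty} → Var Γ T → Env U Γ → T.Obj U
  | _, _, .here, ρ => ρ.1
  | _, _, .there x, ρ => x.eval ρ.2

/-- The value of a term under a binding. -/
def Term.eval {U : Type u} {Γ : Ctx} (ρ : Env U Γ) : {T : Ty} → Term Γ T → T.Obj U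
  | _, .var x => x.eval ρ
  | _, .star => PUnit.unit
  | _, .pair s t => (s.eval ρ, t.eval ρ)
  | _, .fst t => (t.eval ρ).1
  | _, .snd t => (t.eval ρ).2

/-- Membership of an object in an object of set type. -/
def Ty.Mem {U : Type u} {T : Ty} (x : T.Obj U) (s : (Ty.set T).Obj U) : Prop :=
  x ∈ (show Set (T.Obj U) from s)

/-- Truth of a `Δ₀` formula under a binding of its variables to objects over `U`. -/
def Formula.Holds {U : Type u} : {Γ : Ctx} → Formula Γ → Env U Γ → Prop
  | _, .eq s t, ρ => s.eval ρ = t.eval ρ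
  | _, .ne s t, ρ => s.eval ρ ≠ t.eval ρ
  | _, .top, _ => True
  | _, .bot, _ => False
  | _, .or φ ψ, ρ => φ.Holds ρ ∨ ψ.Holds ρ
  | _, .and φ ψ, ρ => φ.Holds ρ ∧ ψ.Holds ρ
  | _, .all (T := T) t φ, ρ => ∀ x : T.Obj U, Ty.Mem x (t.eval ρ) → φ.Holds (x, ρ)
  | _, .ex (T := T) t φ, ρ => ∃ x : T.Obj U, Ty.Mem x (t.eval ρ) ∧ φ.Holds (x, ρ)

/-- `φ(oᵢₙ, oₒᵤₜ, a)` implicitly defines `oₒᵤₜ` as a function of `oᵢₙ`: over every set of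
Ur-elements, two bindings that satisfy `φ` and agree on `oᵢₙ` (but possibly not on the
auxiliary parameters `a`) agree on `oₒᵤₜ`. -/
def ImplicitlyDefines {S T : Ty} {A : Ctx} (φ : Formula (S :: T :: A)) : Prop :=
  ∀ (U : Type u) (i : S.Obj U) (o o' : T.Obj U) (a a' : Env U A),
    φ.Holds (i, o, a) → φ.Holds (i, o', a') → o = o'

end NestedRel

/-! The theorem follows from an interpolation property, `exists_interpolant`, used twice.
Interpolating between φ(i, o, a) and φ(i, o', b) ∧ o ≠ o' gives θ₁(i, o), implied by φ, whose
outputs agree with those of φ. The outputs of θ₁ need not agree among themselves. Interpolating φ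
against θ₁ therefore gives θ₂, implied by φ, whose outputs agree with those of θ₁, and θ₁ ∧ θ₂ is
functional.

Interpolation is proved semantically, by a Henkin construction for two theories. The theories are
separable if some Δ₀ formula in the shared names follows from one and is refuted by the other. An
inseparable pair stays inseparable when one side decides a statement (`Stage.Good.addFact`) and when
an accepted ∃ x ∈ t receives a named witness (`Stage.Good.addWitness`). A witness from a shared set
becomes a shared name, since a bounded quantifier over that set can remove it from a separating
formula. In the limit a set name denotes the set of its named elements, and Ur-names are identified
when a side forces their equality. By inseparability the two sides agree on shared names, so their
identifications amalgamate (`exists_amalgam`). Discarding unnamed elements is harmless: quantifiers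
range only over elements of sets, and neither membership nor equality of higher type is atomic. The
truth lemma `Saturated.holds_collapse` then yields a common model of both sides. If no common model
exists, the theories are separable, and the separating formula is the interpolant. -/

namespace NestedRel

/-! ### Negation and extensional equality -/

/-- Weakening of a term by one variable. -/
def Term.weaken {Γ : Ctx} (R : Ty) : {T : Ty} → Term Γ T → Term (R :: Γ) T
  | _, .var x => .var (.there x)
  | _, .star => .star
  | _, .pair s t => .pair (s.weaken R) (t.weaken R)
  | _, .fst t => .fst (t.weaken R)
  | _, .snd t => .snd (t.weaken R)

theorem Term.eval_weaken {U : Type u} {Γ : Ctx} {R : Ty} (x : R.Obj U) (ρ : Env U Γ) {T : Ty}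
    (t : Term Γ T) : (t.weaken R).eval (U := U) (Γ := R :: Γ) (x, ρ) = t.eval ρ := by
  induction t with
  | var y => rfl
  | star => rfl
  | pair s t hs ht => exact Prod.ext hs ht
  | fst t ht => simp [Term.weaken, Term.eval, ht]
  | snd t ht => simp [Term.weaken, Term.eval, ht]

/-- The dual of a formula, which expresses its negation. -/
def Formula.neg : {Γ : Ctx} → Formula Γ → Formula Γ
  | _, .eq s t => .ne s t
  | _, .ne s t => .eq s t
  | _, .top => .bot
  | _, .bot => .top
  | _, .or φ ψ => .and φ.neg ψ.neg
  | _, .and φ ψ => .or φ.neg ψ.neg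
  | _, .all t φ => .ex t φ.neg
  | _, .ex t φ => .all t φ.neg

theorem Formula.holds_neg {U : Type u} {Γ : Ctx} (φ : Formula Γ) (ρ : Env U Γ) :
    φ.neg.Holds ρ ↔ ¬ φ.Holds ρ := by
  induction φ with
  | eq s t => simp [Formula.neg, Formula.Holds]
  | ne s t => simp [Formula.neg, Formula.Holds]
  | top => simp [Formula.neg, Formula.Holds]
  | bot => simp [Formula.neg, Formula.Holds]
  | or φ ψ h₁ h₂ => simp [Formula.neg, Formula.Holds, h₁, h₂]
  | and φ ψ h₁ h₂ => simp only [Formula.neg, Formula.Holds, h₁, h₂]; tauto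
  | all t φ h =>
    simp only [Formula.neg, Formula.Holds, not_forall, exists_prop]
    exact exists_congr fun x => and_congr_right fun _ => h (x, ρ)
  | ex t φ h =>
    simp only [Formula.neg, Formula.Holds, not_exists, not_and]
    exact forall₂_congr fun x _ => h (x, ρ)

/-- The formula expressing that two terms of arbitrary type have the same value. -/
def Formula.equal : (T : Ty) → {Γ : Ctx} → Term Γ T → Term Γ T → Formula Γ
  | .ur, _, s, t => .eq s t
  | .unit, _, _, _ => .top
  | .prod S T, _, s, t => .and (equal S s.fst t.fst) (equal T s.snd t.snd)
  | .set T, _, s, t =>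
    .and (.all s (.ex (t.weaken T) (equal T (.var (.there .here)) (.var .here))))
      (.all t (.ex (s.weaken T) (equal T (.var .here) (.var (.there .here)))))

/-- Extensionality, unwound along the type, makes equality of every type Δ₀. This allows o ≠ o' to
be used as a fact in the interpolation argument. -/
theorem Formula.holds_equal {U : Type u} (T : Ty) {Γ : Ctx} (s t : Term Γ T) (ρ : Env U Γ) :
    (Formula.equal T s t).Holds ρ ↔ s.eval ρ = t.eval ρ := by
  induction T generalizing Γ with
  | ur => rfl
  | unit => simp [Formula.equal, Formula.Holds]; rfl
  | prod S T hS hT =>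
    simp only [Formula.equal, Formula.Holds, hS, hT, Term.eval]
    exact Prod.ext_iff.symm
  | set T hT =>
    simp only [Formula.equal, Formula.Holds, Term.eval_weaken]
    constructor
    · rintro ⟨h₁, h₂⟩
      apply Set.Subset.antisymm
      · intro x hx
        obtain ⟨y, hy, h⟩ := h₁ x hx
        have h' : x = y := (hT _ _ _).1 h
        exact h' ▸ hy
      · intro x hx
        obtain ⟨y, hy, h⟩ := h₂ x hx
        have h' : y = x := (hT _ _ _).1 h
        exact h' ▸ hy
    · intro h
      rw [h]
      exact ⟨fun x hx => ⟨x, hx, (hT _ _ _).2 rfl⟩, fun x hx => ⟨x, hx, (hT _ _ _).2 rfl⟩⟩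

/-! ### Transport along injections of Ur-elements -/

/-- The action of a map of Ur-elements on objects. -/
def Ty.map {U V : Type u} (f : U → V) : (T : Ty) → T.Obj U → T.Obj V
  | .ur, x => f x
  | .unit, _ => PUnit.unit
  | .prod S T, x => (S.map f x.1, T.map f x.2)
  | .set T, x => (T.map f) '' (show Set (T.Obj U) from x)

/-- The action of a map of Ur-elements on bindings. -/
def Env.map {U V : Type u} (f : U → V) : {Γ : Ctx} → Env U Γ → Env V Γ
  | [], _ => PUnit.unit
  | T :: _, ρ => (T.map f ρ.1, Env.map f ρ.2)

theorem Ty.map_injective {U V : Type u} {f : U → V} (hf : Function.Injective f) (T : Ty) :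
    Function.Injective (T.map f) := by
  induction T with
  | ur => exact hf
  | unit => intro x y _; rfl
  | prod S T hS hT => exact hS.prodMap hT
  | set T hT => exact Set.image_injective.2 hT

theorem Term.eval_map {U V : Type u} (f : U → V) {Γ : Ctx} (ρ : Env U Γ) {T : Ty}
    (t : Term Γ T) : t.eval (ρ.map f) = T.map f (t.eval ρ) := by
  induction t with
  | var x =>
    induction x with
    | here => rfl
    | there x hx => exact hx ρ.2
  | star => rfl
  | pair s t hs ht => exact Prod.ext hs ht
  | fst t ht => simp [Term.eval, ht, Ty.map]
  | snd t ht => simp [Term.eval, ht, Ty.map]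

/-- Bounded quantifiers see only elements of a set, and the elements of an image are images, so
Ur-elements outside the range of `f` are invisible. With `f = some` this replaces a possibly empty
universe by a nonempty one. -/
theorem Formula.holds_map {U V : Type u} {f : U → V} (hf : Function.Injective f) {Γ : Ctx}
    (φ : Formula Γ) (ρ : Env U Γ) : φ.Holds (ρ.map f) ↔ φ.Holds ρ := by
  induction φ with
  | eq s t => simp only [Formula.Holds, Term.eval_map]; exact hf.eq_iff
  | ne s t => simp only [Formula.Holds, Term.eval_map]; exact hf.ne_iff
  | top => rfl
  | bot => rfl
  | or φ ψ h₁ h₂ => simp [Formula.Holds, h₁, h₂]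
  | and φ ψ h₁ h₂ => simp [Formula.Holds, h₁, h₂]
  | @all Γ T t φ h =>
    simp only [Formula.Holds, Term.eval_map]
    exact Set.forall_mem_image.trans (forall₂_congr fun x _ => h (x, ρ))
  | @ex Γ T t φ h =>
    simp only [Formula.Holds, Term.eval_map]
    exact Set.exists_mem_image.trans (exists_congr fun x => and_congr_right fun _ => h (x, ρ))

/-! ### Symbolic objects -/

/-- Names are coloured by the side of an interpolation problem on which they may be used:
`none` stands for names shared by the two sides. -/
abbrev Color : Type := Option Bool

/-- Names and their projections. -/
inductive Neutral : Ty → Type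
  | root (c : Color) (k : ℕ) (T : Ty) : Neutral T
  | fst {S T : Ty} : Neutral (.prod S T) → Neutral S
  | snd {S T : Ty} : Neutral (.prod S T) → Neutral T

/-- The colour, the index and the type of the name from which a neutral is projected. -/
def Neutral.origin : {T : Ty} → Neutral T → Color × ℕ × Ty
  | _, .root c k T => (c, k, T)
  | _, .fst x => x.origin
  | _, .snd x => x.origin

/-- Symbolic objects: tuples of neutrals of Ur-element or set type. -/
def Sym : Ty → Type
  | .ur => Neutral .ur
  | .unit => PUnit
  -- Symbolic objects are η-long: a pair is always explicit, so projections compute and only names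
  -- of Ur-element or set type remain to be interpreted.
  | .prod S T => Sym S × Sym T
  | .set T => Neutral (.set T)

/-- The symbolic object denoted by a neutral. -/
def Neutral.reflect : (T : Ty) → Neutral T → Sym T
  | .ur, x => x
  | .unit, _ => PUnit.unit
  | .prod S T, x => (Neutral.reflect S x.fst, Neutral.reflect T x.snd)
  | .set _, x => x

/-- Bindings of the variables of a context to symbolic objects. -/
def SymEnv : Ctx → Type
  | [] => PUnit
  | T :: Γ => Sym T × SymEnv Γ

/-- The symbolic value of a variable. -/
def Var.symEval : {Γ : Ctx} → {T : Ty} → Var Γ T → SymEnv Γ → Sym T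
  | _, _, .here, σ => σ.1
  | _, _, .there x, σ => x.symEval σ.2

/-- The symbolic value of a term. -/
def Term.symEval {Γ : Ctx} (σ : SymEnv Γ) : {T : Ty} → Term Γ T → Sym T
  | _, .var x => x.symEval σ
  | _, .star => PUnit.unit
  | _, .pair s t => (s.symEval σ, t.symEval σ)
  | _, .fst t => (t.symEval σ).1
  | _, .snd t => (t.symEval σ).2

/-- All names occurring in a symbolic object satisfy `p`. -/
def Sym.Over (p : Color × ℕ × Ty → Prop) : (T : Ty) → Sym T → Prop
  | .ur, x => p (Neutral.origin (T := .ur) x)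
  | .unit, _ => True
  | .prod S T, x => Sym.Over p S x.1 ∧ Sym.Over p T x.2
  | .set T, x => p (Neutral.origin (T := .set T) x)

/-- All names occurring in a symbolic binding satisfy `p`. -/
def SymEnv.Over (p : Color × ℕ × Ty → Prop) : {Γ : Ctx} → SymEnv Γ → Prop
  | [], _ => True
  | T :: _, σ => Sym.Over p T σ.1 ∧ SymEnv.Over p σ.2

theorem Sym.Over.mono {p q : Color × ℕ × Ty → Prop} (h : ∀ r, p r → q r) :
    ∀ {T : Ty} {x : Sym T}, Sym.Over p T x → Sym.Over q T x
  | .ur, _, hx => h _ hx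
  | .unit, _, _ => trivial
  | .prod _ _, _, hx => ⟨Sym.Over.mono h hx.1, Sym.Over.mono h hx.2⟩
  | .set _, _, hx => h _ hx

theorem SymEnv.Over.mono {p q : Color × ℕ × Ty → Prop} (h : ∀ r, p r → q r) :
    ∀ {Γ : Ctx} {σ : SymEnv Γ}, σ.Over p → σ.Over q
  | [], _, _ => trivial
  | _ :: _, _, hσ => ⟨hσ.1.mono h, SymEnv.Over.mono h hσ.2⟩

theorem Neutral.over_reflect {p : Color × ℕ × Ty → Prop} :
    ∀ {T : Ty} {x : Neutral T}, p x.origin → Sym.Over p T (x.reflect T)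
  | .ur, _, hx => hx
  | .unit, _, _ => trivial
  | .prod _ _, x, hx =>
    ⟨Neutral.over_reflect (x := x.fst) hx, Neutral.over_reflect (x := x.snd) hx⟩
  | .set _, _, hx => hx

theorem Term.over_symEval {p : Color × ℕ × Ty → Prop} {Γ : Ctx} {σ : SymEnv Γ} (hσ : σ.Over p)
    {T : Ty} (t : Term Γ T) : Sym.Over p T (t.symEval σ) := by
  induction t with
  | var x =>
    induction x with
    | here => exact hσ.1
    | there x hx => exact hx hσ.2
  | star => trivial
  | pair s t hs ht => exact ⟨hs, ht⟩
  | fst t ht => exact ht.1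
  | snd t ht => exact ht.2

/-- The binding obtained by interpreting the symbolic objects. -/
def SymEnv.interp {U : Type u} (h : ∀ T : Ty, Sym T → T.Obj U) :
    {Γ : Ctx} → SymEnv Γ → Env U Γ
  | [], _ => PUnit.unit
  | T :: _, σ => (h T σ.1, SymEnv.interp h σ.2)

/-- Stated for any interpretation that respects pairs, because it serves both valuations
(`Sym.eval`) and the final model (`collapse`). -/
theorem Term.eval_interp {U : Type u} {h : ∀ T : Ty, Sym T → T.Obj U}
    (hh : ∀ (S T : Ty) (x : Sym S) (y : Sym T), h (.prod S T) (x, y) = (h S x, h T y))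
    {Γ : Ctx} (σ : SymEnv Γ) {T : Ty} (t : Term Γ T) :
    t.eval (σ.interp h) = h T (t.symEval σ) := by
  induction t with
  | var x =>
    induction x with
    | here => rfl
    | there x hx => exact hx σ.2
  | star => rfl
  | pair s t hs ht => simp only [Term.eval, hs, ht]; exact (hh _ _ _ _).symm
  | @fst S T t ht =>
    simp only [Term.eval, ht]; exact congrArg Prod.fst (hh S T (t.symEval σ).1 (t.symEval σ).2)
  | @snd S T t ht =>
    simp only [Term.eval, ht]; exact congrArg Prod.snd (hh S T (t.symEval σ).1 (t.symEval σ).2)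

/-! ### Valuations of names -/

/-- An assignment of objects over `U` to all names. -/
abbrev Valuation (U : Type u) : Type u := Color → ℕ → (T : Ty) → T.Obj U

/-- The value of a neutral. -/
def Neutral.eval {U : Type u} (v : Valuation U) : {T : Ty} → Neutral T → T.Obj U
  | _, .root c k T => v c k T
  | _, .fst x => (x.eval v).1
  | _, .snd x => (x.eval v).2

/-- The value of a symbolic object. -/
def Sym.eval {U : Type u} (v : Valuation U) : (T : Ty) → Sym T → T.Obj U
  | .ur, x => Neutral.eval (T := .ur) v x
  | .unit, _ => PUnit.unit
  | .prod S T, x => (Sym.eval v S x.1, Sym.eval v T x.2)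
  | .set T, x => Neutral.eval (T := .set T) v x

theorem Sym.eval_reflect {U : Type u} (v : Valuation U) :
    ∀ {T : Ty} (x : Neutral T), Sym.eval v T (x.reflect T) = x.eval v
  | .ur, _ => rfl
  | .unit, _ => rfl
  | .prod _ _, x => Prod.ext (Sym.eval_reflect v x.fst) (Sym.eval_reflect v x.snd)
  | .set _, _ => rfl

theorem Term.eval_symEval {U : Type u} (v : Valuation U) {Γ : Ctx} (σ : SymEnv Γ) {T : Ty}
    (t : Term Γ T) : t.eval (σ.interp (Sym.eval v)) = Sym.eval v T (t.symEval σ) :=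
  Term.eval_interp (fun _ _ _ _ => rfl) σ t

theorem Neutral.eval_congr {U : Type u} {v w : Valuation U} :
    ∀ {T : Ty} (x : Neutral T),
      v x.origin.1 x.origin.2.1 x.origin.2.2 = w x.origin.1 x.origin.2.1 x.origin.2.2 →
      x.eval v = x.eval w
  | _, .root _ _ _, h => h
  | _, .fst x, h => congrArg Prod.fst (Neutral.eval_congr x h)
  | _, .snd x, h => congrArg Prod.snd (Neutral.eval_congr x h)

theorem Sym.eval_congr {U : Type u} {v w : Valuation U} {p : Color × ℕ × Ty → Prop}
    (h : ∀ r, p r → v r.1 r.2.1 r.2.2 = w r.1 r.2.1 r.2.2) :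
    ∀ {T : Ty} (x : Sym T), Sym.Over p T x → Sym.eval v T x = Sym.eval w T x
  | .ur, x, hx => Neutral.eval_congr (T := .ur) x (h _ hx)
  | .unit, _, _ => rfl
  | .prod _ _, x, hx => Prod.ext (Sym.eval_congr h x.1 hx.1) (Sym.eval_congr h x.2 hx.2)
  | .set T, x, hx => Neutral.eval_congr (T := .set T) x (h _ hx)

theorem SymEnv.interp_congr {U : Type u} {v w : Valuation U} {p : Color × ℕ × Ty → Prop}
    (h : ∀ r, p r → v r.1 r.2.1 r.2.2 = w r.1 r.2.1 r.2.2) :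
    ∀ {Γ : Ctx} (σ : SymEnv Γ), σ.Over p → σ.interp (Sym.eval v) = σ.interp (Sym.eval w)
  | [], _, _ => rfl
  | _ :: _, σ, hσ => Prod.ext (Sym.eval_congr h σ.1 hσ.1) (SymEnv.interp_congr h σ.2 hσ.2)

open Classical in
/-- The valuation that differs from `v` only at one name. -/
noncomputable def Valuation.set {U : Type u} (v : Valuation U) (c : Color) (k : ℕ) (T : Ty)
    (x : T.Obj U) : Valuation U :=
  Function.update v c (Function.update (v c) k (Function.update (v c k) T x))

@[simp]
theorem Valuation.set_self {U : Type u} (v : Valuation U) (c : Color) (k : ℕ) (T : Ty)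
    (x : T.Obj U) : v.set c k T x c k T = x := by
  simp [Valuation.set]

theorem Valuation.set_of_ne {U : Type u} (v : Valuation U) {c c' : Color} {k k' : ℕ} {T T' : Ty}
    (x : T.Obj U) (h : ¬ (c' = c ∧ k' = k)) : v.set c k T x c' k' T' = v c' k' T' := by
  unfold Valuation.set
  by_cases hc : c' = c
  · subst hc
    have hk : k' ≠ k := fun hk => h ⟨rfl, hk⟩
    simp [hk]
  · simp [hc]

/-- The names of colour `c` and consecutive indices, starting at `k`, for the variables of a
context. -/
def Ctx.names (c : Color) : ℕ → (Γ : Ctx) → SymEnv Γ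
  | _, [] => PUnit.unit
  | k, T :: Γ => ((Neutral.root c k T).reflect T, Ctx.names c (k + 1) Γ)

theorem Ctx.names_over {c : Color} {p : Color × ℕ × Ty → Prop} :
    ∀ {k : ℕ} {Γ : Ctx}, (∀ j T, k ≤ j → j < k + Γ.length → p (c, j, T)) →
      (Ctx.names c k Γ).Over p
  | _, [], _ => trivial
  | k, T :: Γ, h => by
    refine ⟨Neutral.over_reflect (h k T le_rfl (by simp)), Ctx.names_over fun j T hj hj' => ?_⟩
    exact h j T (by omega) (by simp only [List.length_cons]; omega)

theorem Valuation.exists_interp_names {U : Type u} (v : Valuation U) (c : Color) :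
    ∀ (k : ℕ) {Γ : Ctx} (ρ : Env U Γ), ∃ w : Valuation U,
      (Ctx.names c k Γ).interp (Sym.eval w) = ρ ∧
      ∀ c' k' T, ¬ (c' = c ∧ k ≤ k') → w c' k' T = v c' k' T
  | _, [], _ => ⟨v, rfl, fun _ _ _ _ => rfl⟩
  | k, T :: Γ, ρ => by
    obtain ⟨w, hw, hw'⟩ := Valuation.exists_interp_names v c (k + 1) (Γ := Γ) ρ.2
    refine ⟨w.set c k T ρ.1, Prod.ext ?_ ?_, ?_⟩
    · exact (Sym.eval_reflect _ _).trans (Valuation.set_self ..)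
    · refine Eq.trans (SymEnv.interp_congr (p := fun r => k + 1 ≤ r.2.1) ?_ _ ?_) hw
      · intro r hr
        exact Valuation.set_of_ne _ _ fun h => by omega
      · exact Ctx.names_over fun j _ hj _ => hj
    · intro c' k' T' h
      rw [Valuation.set_of_ne _ _ fun h' => h ⟨h'.1, h'.2.ge⟩]
      exact hw' _ _ _ fun h' => h ⟨h'.1, by omega⟩

/-! ### Countability of the syntax -/

/-- A type all of whose elements are generated from countably many basic elements by countably
many partial binary operations is countable. -/
theorem countable_of_generated {X J : Type} [Countable J] (size : X → ℕ) (base : J → Option X)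
    (op : J → X → X → Option X)
    (h : ∀ x, (∃ j, base j = some x) ∨
      ∃ j y z, size y < size x ∧ size z < size x ∧ op j y z = some x) : Countable X := by
  -- An element of size at most `n` is basic or the value of some `op j` at elements of size below
  -- `n`. Partiality of `op` lets it act on sigma types, where only operands with matching indices
  -- combine.
  have key : ∀ n, {x | size x < n}.Countable := by
    intro n
    induction n with
    | zero => simp
    | succ n ih =>
      have h₁ : (some ⁻¹' Set.range base : Set X).Countable :=
        (Set.countable_range base).preimage (Option.some_injective X)
      have h₂ : (⋃ j, some ⁻¹' Set.image2 (op j) {x | size x < n} {x | size x < n} :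
          Set X).Countable :=
        Set.countable_iUnion fun j => (ih.image2 ih (op j)).preimage (Option.some_injective X)
      refine (h₁.union h₂).mono fun x hx => ?_
      rcases h x with ⟨j, hj⟩ | ⟨j, y, z, hy, hz, hj⟩
      · exact Or.inl ⟨j, hj⟩
      · have hx' : size x < n + 1 := hx
        refine Or.inr (Set.mem_iUnion.2 ⟨j, y, ?_, z, ?_, hj⟩)
        · exact (by omega : size y < n)
        · exact (by omega : size z < n)
  have huniv : (Set.univ : Set X) = ⋃ n, {x | size x < n} := by
    ext x
    simpa using ⟨size x + 1, Nat.lt_succ_self _⟩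
  rw [← Set.countable_univ_iff, huniv]
  exact Set.countable_iUnion key

instance : Countable Ty := by
  refine countable_of_generated (J := Bool) sizeOf
    (fun j => if j then some .ur else some .unit)
    (fun j S T => if j then some (.prod S T) else some (.set T)) ?_
  intro x
  cases x with
  | ur => exact Or.inl ⟨true, rfl⟩
  | unit => exact Or.inl ⟨false, rfl⟩
  | prod S T => exact Or.inr ⟨true, S, T, by simp; omega, by simp, rfl⟩
  | set T => exact Or.inr ⟨false, T, T, by simp, by simp, rfl⟩

instance Var.countable : ∀ (Γ : Ctx) (T : Ty), Countable (Var Γ T)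
  | [], T => ⟨fun _ => 0, fun x => nomatch x⟩
  | S :: Γ, T => by
    have := Var.countable Γ T
    refine Function.Injective.countable (β := Option (Var Γ T))
      (f := fun x => match x with
        | .here => none
        | .there x => some x) ?_
    intro x y h
    cases x <;> cases y <;> simp_all

instance (Γ : Ctx) : Countable (Σ T, Term Γ T) := by
  refine countable_of_generated (J := Option (Fin 3 ⊕ Σ T, Var Γ T)) (fun x => sizeOf x.2)
    (fun j => match j with
      | some (.inr x) => some ⟨x.1, .var x.2⟩
      | _ => some ⟨.unit, .star⟩)
    (fun j x y => match j, x with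
      | none, x => some ⟨_, .pair x.2 y.2⟩
      | some (.inl 0), ⟨.prod _ _, t⟩ => some ⟨_, .fst t⟩
      | some (.inl 1), ⟨.prod _ _, t⟩ => some ⟨_, .snd t⟩
      | _, _ => none) ?_
  rintro ⟨T, t⟩
  cases t with
  | var x => exact Or.inl ⟨some (.inr ⟨T, x⟩), rfl⟩
  | star => exact Or.inl ⟨none, rfl⟩
  | pair s t => exact Or.inr ⟨none, ⟨_, s⟩, ⟨_, t⟩, by simp; omega, by simp, rfl⟩
  | fst t => exact Or.inr ⟨some (.inl 0), ⟨_, t⟩, ⟨_, t⟩, by simp, by simp, rfl⟩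
  | snd t => exact Or.inr ⟨some (.inl 1), ⟨_, t⟩, ⟨_, t⟩, by simp, by simp, rfl⟩

instance : Countable (Σ T, Neutral T) := by
  refine countable_of_generated (J := Bool ⊕ Color × ℕ × Ty) (fun x => sizeOf x.2)
    (fun j => match j with
      | .inr x => some ⟨x.2.2, .root x.1 x.2.1 x.2.2⟩
      | _ => none)
    (fun j x _ => match j, x with
      | .inl true, ⟨.prod _ _, x⟩ => some ⟨_, .fst x⟩
      | .inl false, ⟨.prod _ _, x⟩ => some ⟨_, .snd x⟩
      | _, _ => none) ?_
  rintro ⟨T, x⟩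
  cases x with
  | root c k => exact Or.inl ⟨.inr (c, k, T), rfl⟩
  | fst x => exact Or.inr ⟨.inl true, ⟨_, x⟩, ⟨_, x⟩, by simp, by simp, rfl⟩
  | snd x => exact Or.inr ⟨.inl false, ⟨_, x⟩, ⟨_, x⟩, by simp, by simp, rfl⟩

instance (Γ : Ctx) (T : Ty) : Countable (Term Γ T) :=
  (sigma_mk_injective (i := T) (β := Term Γ)).countable

instance (T : Ty) : Countable (Neutral T) :=
  (sigma_mk_injective (i := T) (β := Neutral)).countable

open Classical in
instance : Countable (Σ Γ, Formula Γ) := by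
  refine countable_of_generated
    (J := Bool × (Ctx ⊕ (Σ Γ : Ctx, Term Γ .ur × Term Γ .ur) ⊕
      Σ (Γ : Ctx) (T : Ty), Term Γ (.set T)))
    (fun x => sizeOf x.2)
    (fun j => match j with
      | (true, .inl Γ) => some ⟨Γ, .top⟩
      | (false, .inl Γ) => some ⟨Γ, .bot⟩
      | (true, .inr (.inl x)) => some ⟨x.1, .eq x.2.1 x.2.2⟩
      | (false, .inr (.inl x)) => some ⟨x.1, .ne x.2.1 x.2.2⟩
      | _ => none)
    (fun j x y => match j with
      | (true, .inl _) => if h : y.1 = x.1 then some ⟨x.1, .or x.2 (h ▸ y.2)⟩ else none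
      | (false, .inl _) => if h : y.1 = x.1 then some ⟨x.1, .and x.2 (h ▸ y.2)⟩ else none
      | (true, .inr (.inr ⟨Γ, T, t⟩)) =>
        if h : x.1 = T :: Γ then some ⟨Γ, .all t (h ▸ x.2)⟩ else none
      | (false, .inr (.inr ⟨Γ, T, t⟩)) =>
        if h : x.1 = T :: Γ then some ⟨Γ, .ex t (h ▸ x.2)⟩ else none
      | _ => none) ?_
  rintro ⟨Γ, φ⟩
  cases φ with
  | eq s t => exact Or.inl ⟨(true, .inr (.inl ⟨Γ, s, t⟩)), rfl⟩
  | ne s t => exact Or.inl ⟨(false, .inr (.inl ⟨Γ, s, t⟩)), rfl⟩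
  | top => exact Or.inl ⟨(true, .inl Γ), rfl⟩
  | bot => exact Or.inl ⟨(false, .inl Γ), rfl⟩
  | or φ ψ =>
    exact Or.inr ⟨(true, .inl Γ), ⟨Γ, φ⟩, ⟨Γ, ψ⟩, by simp; omega, by simp, by simp⟩
  | and φ ψ =>
    exact Or.inr ⟨(false, .inl Γ), ⟨Γ, φ⟩, ⟨Γ, ψ⟩, by simp; omega, by simp, by simp⟩
  | all t φ =>
    exact Or.inr ⟨(true, .inr (.inr ⟨Γ, _, t⟩)), ⟨_, φ⟩, ⟨_, φ⟩, by simp, by simp, by simp⟩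
  | ex t φ =>
    exact Or.inr ⟨(false, .inr (.inr ⟨Γ, _, t⟩)), ⟨_, φ⟩, ⟨_, φ⟩, by simp, by simp, by simp⟩

instance Sym.countable : ∀ T : Ty, Countable (Sym T)
  | .ur => inferInstanceAs (Countable (Neutral .ur))
  | .unit => inferInstanceAs (Countable PUnit)
  | .prod S T => by
    have := Sym.countable S
    have := Sym.countable T
    exact inferInstanceAs (Countable (Sym S × Sym T))
  | .set T => inferInstanceAs (Countable (Neutral (.set T)))

instance SymEnv.countable : ∀ Γ : Ctx, Countable (SymEnv Γ)
  | [] => inferInstanceAs (Countable PUnit)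
  | T :: Γ => by
    have := SymEnv.countable Γ
    exact inferInstanceAs (Countable (Sym T × SymEnv Γ))

/-! ### Statements about names and their enumeration. -/

/-- An instance of a formula at symbolic objects. -/
abbrev Statement : Type := Σ φ : (Σ Γ, Formula Γ), SymEnv φ.1

/-- The statement that `φ` holds at `σ`. -/
abbrev Formula.at {Γ : Ctx} (φ : Formula Γ) (σ : SymEnv Γ) : Statement := ⟨⟨Γ, φ⟩, σ⟩

/-- Truth of a statement under a valuation. -/
def Statement.Holds {U : Type u} (q : Statement) (v : Valuation U) : Prop :=
  q.1.2.Holds (q.2.interp (Sym.eval v))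

/-- There is an enumeration of a countable type in which every element occurs infinitely often. -/
theorem exists_enumeration (X : Type) [Countable X] [Nonempty X] :
    ∃ e : ℕ → X, ∀ (x : X) (n : ℕ), ∃ k, n ≤ k ∧ e k = x := by
  obtain ⟨f, hf⟩ := exists_surjective_nat X
  refine ⟨fun k => f k.unpair.1, fun x n => ?_⟩
  obtain ⟨m, rfl⟩ := hf x
  exact ⟨Nat.pair m n, Nat.right_le_pair m n, by simp⟩

/-! ### Stages of the construction -/

/-- The finite part of a construction of a model of two theories with shared names: all names
have an index below `fresh`, `shared` lists the shared names, `facts b` is the theory of the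
side `b`, and `mems` contains `⟨T, k, x⟩` if the name of index `k` and type `T`, with the colour
of `x`, is declared to be an element of `x`. -/
structure Stage where
  fresh : ℕ
  shared : List (ℕ × Ty)
  facts : Bool → Set Statement
  mems : Set (Σ T : Ty, ℕ × Neutral (.set T))

/-- The names that are in use on the side `b`. -/
def Stage.Known (st : Stage) (b : Bool) (r : Color × ℕ × Ty) : Prop :=
  r.2.1 < st.fresh ∧ (r.1 = none ∧ r.2 ∈ st.shared ∨ r.1 = some b)

/-- Only names in use occur in a stage. -/
structure Stage.WF (st : Stage) : Prop where
  facts : ∀ b, ∀ q ∈ st.facts b, q.2.Over (st.Known b)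
  mems : ∀ m ∈ st.mems, m.2.1 < st.fresh ∧ m.2.2.origin.2.1 < st.fresh ∧
    (m.2.2.origin.1 = none → (m.2.1, m.1) ∈ st.shared)
  shared : ∀ p ∈ st.shared, p.1 < st.fresh

/-- The valuation `v` satisfies the facts and the declarations of the side `b`. -/
def Stage.Models (st : Stage) (b : Bool) {U : Type u} (v : Valuation U) : Prop :=
  (∀ q ∈ st.facts b, q.Holds v) ∧
  -- A side ignores declarations about the private sets of the other side, so these never affect its
  -- models.
  ∀ m ∈ st.mems, m.2.2.origin.1 = none ∨ m.2.2.origin.1 = some b →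
    Ty.Mem (v m.2.2.origin.1 m.2.1 m.1) (m.2.2.eval v)

/-- The symbolic binding of a list of shared names. -/
def sharedEnv : (l : List (ℕ × Ty)) → SymEnv (l.map Prod.snd)
  | [] => PUnit.unit
  | p :: l => ((Neutral.root none p.1 p.2).reflect p.2, sharedEnv l)

/-- Some formula about the shared names follows from the side `b` and is refuted by the other
side. -/
def Stage.Separable (st : Stage) (b : Bool) : Prop :=
  ∃ θ : Formula (st.shared.map Prod.snd),
    (∀ (U : Type u) (v : Valuation U), st.Models b v →
      θ.Holds ((sharedEnv st.shared).interp (Sym.eval v))) ∧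
    ∀ (U : Type u) (v : Valuation U), st.Models (!b) v →
      ¬ θ.Holds ((sharedEnv st.shared).interp (Sym.eval v))

/-- Δ₀ formulas are closed under negation, and the dual of a separating formula separates in the
other direction. -/
theorem Stage.Separable.swap {st : Stage} {b : Bool} (h : Stage.Separable.{u} st b) :
    Stage.Separable.{u} st (!b) := by
  obtain ⟨θ, h₁, h₂⟩ := h
  refine ⟨θ.neg, fun U v hv => (Formula.holds_neg _ _).2 (h₂ U v hv), fun U v hv => ?_⟩
  rw [Formula.holds_neg, not_not]
  exact h₁ U v (by simpa using hv)

theorem Stage.Separable.of_side {st : Stage} {b c : Bool} (h : Stage.Separable.{u} st b) :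
    Stage.Separable.{u} st c := by
  by_cases hbc : b = c
  · exact hbc ▸ h
  · have hc : c = !b := by cases b <;> cases c <;> simp_all
    exact hc ▸ h.swap

/-- The stages from which a model can be constructed. -/
structure Stage.Good (st : Stage) : Prop where
  wf : st.WF
  inseparable : ∀ b, ¬ Stage.Separable.{u} st b

/-- If a side had no model, ⊥ would separate it from the other. -/
theorem Stage.Good.exists_models {st : Stage} (h : Stage.Good.{u} st) (b : Bool) :
    ∃ (U : Type u) (v : Valuation U), st.Models b v := by
  by_contra hc
  push Not at hc
  exact h.inseparable b ⟨.bot, fun U v hv => (hc U v hv).elim, fun _ _ _ hv => hv⟩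

/-- The stage `st'` extends `st`. -/
structure Stage.Le (st st' : Stage) : Prop where
  fresh : st.fresh ≤ st'.fresh
  shared : st.shared ⊆ st'.shared
  facts : ∀ b, st.facts b ⊆ st'.facts b
  mems : st.mems ⊆ st'.mems

theorem Stage.Le.refl (st : Stage) : st.Le st :=
  ⟨le_rfl, fun _ h => h, fun _ _ h => h, fun _ h => h⟩

theorem Stage.Le.trans {st₁ st₂ st₃ : Stage} (h : st₁.Le st₂) (h' : st₂.Le st₃) : st₁.Le st₃ :=
  ⟨h.fresh.trans h'.fresh, fun _ hx => h'.shared (h.shared hx),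
    fun b _ hx => h'.facts b (h.facts b hx), fun _ hx => h'.mems (h.mems hx)⟩

theorem Stage.Le.known {st st' : Stage} (h : st.Le st') {b : Bool} {r : Color × ℕ × Ty}
    (hr : st.Known b r) : st'.Known b r :=
  ⟨hr.1.trans_le h.fresh, hr.2.imp_left fun hr => ⟨hr.1, h.shared hr.2⟩⟩

theorem Stage.Le.models {st st' : Stage} (h : st.Le st') {b : Bool} {U : Type u}
    {v : Valuation U} (hv : st'.Models b v) : st.Models b v :=
  ⟨fun q hq => hv.1 q (h.facts b hq), fun m hm => hv.2 m (h.mems hm)⟩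

/-- A neutral projected from a shared name is the value of a term in the shared names. -/
theorem exists_term_of_shared {l : List (ℕ × Ty)} :
    ∀ {T : Ty} (x : Neutral T), x.origin.1 = none → x.origin.2 ∈ l →
      ∃ t : Term (l.map Prod.snd) T, t.symEval (sharedEnv l) = x.reflect T
  | _, .root c k T, hc, hl => by
    obtain rfl : c = none := hc
    have hl' : (k, T) ∈ l := hl
    have : ∃ x : Var (l.map Prod.snd) T,
        x.symEval (sharedEnv l) = (Neutral.root none k T).reflect T := by
      clear hl
      induction l with
      | nil => simp at hl'
      | cons p l ih =>
        rcases List.mem_cons.1 hl' with rfl | h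
        · exact ⟨.here, rfl⟩
        · obtain ⟨x, hx⟩ := ih h
          exact ⟨.there x, hx⟩
    obtain ⟨x, hx⟩ := this
    exact ⟨.var x, hx⟩
  | _, .fst x, hc, hl => by
    obtain ⟨t, ht⟩ := exists_term_of_shared x hc hl
    exact ⟨t.fst, congrArg Prod.fst ht⟩
  | _, .snd x, hc, hl => by
    obtain ⟨t, ht⟩ := exists_term_of_shared x hc hl
    exact ⟨t.snd, congrArg Prod.snd ht⟩

theorem sharedEnv_over {p : Color × ℕ × Ty → Prop} :
    ∀ {l : List (ℕ × Ty)}, (∀ x ∈ l, p (none, x)) → (sharedEnv l).Over p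
  | [], _ => trivial
  | x :: _, h => ⟨Neutral.over_reflect (h x (by simp)),
      sharedEnv_over fun y hy => h y (by simp [hy])⟩

/-- A change of names that are not in use does not affect the facts and the declarations. -/
theorem Stage.WF.models_congr {st : Stage} (h : st.WF) {b : Bool} {U : Type u}
    {v w : Valuation U} (hvw : ∀ c k T, k < st.fresh → v c k T = w c k T)
    (hv : st.Models b v) : st.Models b w := by
  constructor
  · intro q hq
    have := hv.1 q hq
    unfold Statement.Holds at this ⊢
    rwa [← SymEnv.interp_congr (fun r hr => hvw r.1 r.2.1 r.2.2 hr.1) q.2 (h.facts b q hq)]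
  · intro m hm hc
    have := hv.2 m hm hc
    rwa [hvw _ _ _ (h.mems m hm).1, Neutral.eval_congr m.2.2 (hvw _ _ _ (h.mems m hm).2.1)]
      at this

theorem Stage.WF.shared_congr {st : Stage} (h : st.WF) {U : Type u}
    {v w : Valuation U} (hvw : ∀ c k T, k < st.fresh → v c k T = w c k T) :
    (sharedEnv st.shared).interp (Sym.eval v) = (sharedEnv st.shared).interp (Sym.eval w) :=
  SymEnv.interp_congr (fun r hr => hvw r.1 r.2.1 r.2.2 hr) _
    (sharedEnv_over (p := fun r => r.2.1 < st.fresh) h.shared)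

/-! ### Extending a good stage by a fact or a witness. -/

/-- The stage with one more fact. -/
def Stage.addFact (st : Stage) (b : Bool) (q : Statement) : Stage :=
  { st with facts := fun c => if c = b then insert q (st.facts c) else st.facts c }

theorem Stage.le_addFact (st : Stage) (b : Bool) (q : Statement) : st.Le (st.addFact b q) := by
  refine ⟨le_rfl, fun _ h => h, fun c x hx => ?_, fun _ h => h⟩
  simp only [Stage.addFact]
  split_ifs
  · exact Or.inr hx
  · exact hx

theorem Stage.mem_addFact (st : Stage) (b : Bool) (q : Statement) :
    q ∈ (st.addFact b q).facts b := by
  simp [Stage.addFact]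

theorem Stage.WF.addFact {st : Stage} (h : st.WF) {b : Bool} {q : Statement}
    (hq : q.2.Over (st.Known b)) : (st.addFact b q).WF := by
  refine ⟨fun c x hx => ?_, h.mems, h.shared⟩
  simp only [Stage.addFact] at hx
  split_ifs at hx with hc
  · rcases hx with rfl | hx
    · exact hc ▸ hq
    · exact h.facts c x hx
  · exact h.facts c x hx

theorem Stage.models_addFact {st : Stage} {b : Bool} {q : Statement} {U : Type u}
    {v : Valuation U} (hv : st.Models b v) (hq : q.Holds v) : (st.addFact b q).Models b v := by
  refine ⟨fun x hx => ?_, hv.2⟩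
  simp only [Stage.addFact, if_true] at hx
  rcases hx with rfl | hx
  · exact hq
  · exact hv.1 x hx

theorem Stage.models_addFact_not {st : Stage} {b : Bool} {q : Statement} {U : Type u}
    {v : Valuation U} (hv : st.Models (!b) v) : (st.addFact b q).Models (!b) v := by
  refine ⟨fun x hx => ?_, hv.2⟩
  simp only [Stage.addFact] at hx
  rw [if_neg (by simp)] at hx
  exact hv.1 x hx

/-- Every model of the side `b` satisfies `φ` or its dual. If both extensions were separable, the
disjunction of the two separating formulas would separate the original stage. -/
theorem Stage.Good.addFact {st : Stage} (h : Stage.Good.{u} st) {b : Bool} {Γ : Ctx}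
    (φ : Formula Γ) {σ : SymEnv Γ} (hσ : σ.Over (st.Known b)) :
    Stage.Good.{u} (st.addFact b (φ.at σ)) ∨ Stage.Good.{u} (st.addFact b (φ.neg.at σ)) := by
  by_contra hc
  rw [not_or] at hc
  obtain ⟨h₁, h₂⟩ := hc
  have h₁' : Stage.Separable.{u} (st.addFact b (φ.at σ)) b := by
    by_contra hs
    exact h₁ ⟨h.wf.addFact hσ, fun _ hs' => hs hs'.of_side⟩
  have h₂' : Stage.Separable.{u} (st.addFact b (φ.neg.at σ)) b := by
    by_contra hs
    exact h₂ ⟨h.wf.addFact hσ, fun _ hs' => hs hs'.of_side⟩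
  obtain ⟨θ₁, h₁₁, h₁₂⟩ := h₁'
  obtain ⟨θ₂, h₂₁, h₂₂⟩ := h₂'
  refine h.inseparable b ⟨.or θ₁ θ₂, fun U v hv => ?_, fun U v hv => ?_⟩
  · by_cases hφ : φ.Holds (σ.interp (Sym.eval v))
    · exact Or.inl (h₁₁ U v (Stage.models_addFact hv hφ))
    · exact Or.inr (h₂₁ U v (Stage.models_addFact hv ((Formula.holds_neg _ _).2 hφ)))
  · rintro (h' | h')
    · exact h₁₂ U v (Stage.models_addFact_not hv) h'
    · exact h₂₂ U v (Stage.models_addFact_not hv) h'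

/-- The stage in which the first fresh name is declared to be an element of `x`. -/
def Stage.addMem (st : Stage) {T : Ty} (x : Neutral (.set T)) : Stage where
  fresh := st.fresh + 1
  -- A named element of a shared set must be shared, since both sides may quantify over that set.
  shared := if x.origin.1 = none then (st.fresh, T) :: st.shared else st.shared
  facts := st.facts
  mems := insert ⟨T, st.fresh, x⟩ st.mems

theorem Stage.le_addMem (st : Stage) {T : Ty} (x : Neutral (.set T)) : st.Le (st.addMem x) := by
  refine ⟨Nat.le_succ _, fun y hy => ?_, fun _ _ h => h, fun _ h => Or.inr h⟩
  simp only [Stage.addMem]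
  split_ifs
  · exact List.mem_cons_of_mem _ hy
  · exact hy

theorem Stage.WF.addMem {st : Stage} (h : st.WF) {T : Ty} {x : Neutral (.set T)}
    (hx : x.origin.2.1 < st.fresh) : (st.addMem x).WF := by
  have hle := st.le_addMem x
  refine ⟨fun b q hq => (h.facts b q hq).mono fun r hr => hle.known hr, ?_, ?_⟩
  · rintro m (rfl | hm)
    · refine ⟨Nat.lt_succ_self _, Nat.lt_succ_of_lt hx, fun hc => ?_⟩
      simp only [Stage.addMem]
      rw [if_pos hc]
      exact List.mem_cons_self
    · obtain ⟨h₁, h₂, h₃⟩ := h.mems m hm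
      exact ⟨Nat.lt_succ_of_lt h₁, Nat.lt_succ_of_lt h₂, fun hc => hle.shared (h₃ hc)⟩
  · intro p hp
    simp only [Stage.addMem] at hp ⊢
    split_ifs at hp
    · rcases List.mem_cons.1 hp with rfl | hp
      · exact Nat.lt_succ_self _
      · exact Nat.lt_succ_of_lt (h.shared p hp)
    · exact Nat.lt_succ_of_lt (h.shared p hp)

theorem Stage.WF.models_addMem {st : Stage} (h : st.WF) {b : Bool} {T : Ty} {x : Neutral (.set T)}
    (hx : x.origin.2.1 < st.fresh) {U : Type u} {v : Valuation U} (hv : st.Models b v)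
    {o : T.Obj U} (ho : Ty.Mem o (x.eval v)) :
    (st.addMem x).Models b (v.set x.origin.1 st.fresh T o) := by
  have hvw : ∀ c k T', k < st.fresh → v c k T' = v.set x.origin.1 st.fresh T o c k T' :=
    fun c k T' hk => (Valuation.set_of_ne _ _ fun h => by omega).symm
  have hw := h.models_congr hvw hv
  refine ⟨hw.1, ?_⟩
  rintro m (rfl | hm) hc
  · simp only [Valuation.set_self]
    rwa [← Neutral.eval_congr x (hvw _ _ _ hx)]
  · exact hw.2 m hm hc

/-- A stage remains good when a witness of an existential fact is added. -/
theorem Stage.Good.addWitness {st : Stage} (h : Stage.Good.{u} st) {b : Bool} {Γ : Ctx} {T : Ty}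
    {t : Term Γ (.set T)} {φ : Formula (T :: Γ)} {σ : SymEnv Γ}
    (hq : (Formula.ex t φ).at σ ∈ st.facts b) (x : Neutral (.set T)) (hxt : t.symEval σ = x) :
    Stage.Good.{u} ((st.addMem x).addFact b
      (φ.at (Γ := T :: Γ) ((Neutral.root x.origin.1 st.fresh T).reflect T, σ))) := by
  have hσ : σ.Over (st.Known b) := h.wf.facts b _ hq
  have hx : st.Known b x.origin := by
    have := Term.over_symEval hσ t
    rwa [hxt] at this
  have hwf := h.wf.addMem hx.1
  have hle := st.le_addMem x
  refine ⟨hwf.addFact ⟨Neutral.over_reflect ⟨Nat.lt_succ_self _, ?_⟩,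
    hσ.mono fun r hr => hle.known hr⟩, ?_⟩
  · refine hx.2.imp (fun hc => ⟨hc.1, ?_⟩) id
    simp only [Neutral.origin, Stage.addMem]
    rw [if_pos hc.1]
    exact List.mem_cons_self
  -- the value of the bound and the effect of choosing a witness
  have hval : ∀ {U : Type u} (v : Valuation U),
      t.eval (σ.interp (Sym.eval v)) = x.eval v := by
    intro U v
    rw [Term.eval_symEval, hxt]
    rfl
  have hvw : ∀ {U : Type u} (v : Valuation U) (o : T.Obj U), ∀ c k T', k < st.fresh →
      v c k T' = v.set x.origin.1 st.fresh T o c k T' :=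
    fun v o c k T' hk => (Valuation.set_of_ne _ _ fun h => by omega).symm
  have hwit : ∀ {U : Type u} (v : Valuation U), st.Models b v → ∃ o : T.Obj U,
      Ty.Mem o (x.eval v) ∧ ((st.addMem x).addFact b
        (φ.at (Γ := T :: Γ) ((Neutral.root x.origin.1 st.fresh T).reflect T, σ))).Models b
          (v.set x.origin.1 st.fresh T o) := by
    intro U v hv
    obtain ⟨o, ho, hφ⟩ := hv.1 _ hq
    rw [hval v] at ho
    refine ⟨o, ho, Stage.models_addFact (h.wf.models_addMem hx.1 hv ho) ?_⟩
    have hσ' := SymEnv.interp_congr (fun r hr => hvw v o r.1 r.2.1 r.2.2 hr.1) σ hσ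
    have ho' : Sym.eval (v.set x.origin.1 st.fresh T o) T
        ((Neutral.root x.origin.1 st.fresh T).reflect T) = o :=
      (Sym.eval_reflect _ _).trans (Valuation.set_self ..)
    change φ.Holds (Sym.eval (v.set x.origin.1 st.fresh T o) T
      ((Neutral.root x.origin.1 st.fresh T).reflect T), σ.interp (Sym.eval _))
    rw [ho', ← hσ']
    exact hφ
  intro b' hs
  replace hs := hs.of_side (c := b)
  -- For a shared bound, a separating formula may mention the new name. It is quantified away by ∃
  -- over the bound, rewritten as a term `t'` in shared names. The other side knows only that the
  -- new name lies in the bound, so it refutes the formula for every element. For a private bound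
  -- the shared names do not change and the other side ignores the declaration, so the same formula
  -- already separates `st`.
  rcases hx.2 with ⟨hc, hl⟩ | hc
  · have hsh : ((st.addMem x).addFact b
        (φ.at (Γ := T :: Γ) ((Neutral.root x.origin.1 st.fresh T).reflect T, σ))).shared =
          (st.fresh, T) :: st.shared := if_pos hc
    unfold Stage.Separable at hs
    rw [hsh] at hs
    obtain ⟨θ, h₁, h₂⟩ := hs
    obtain ⟨t', ht'⟩ := exists_term_of_shared x hc hl
    have hval' : ∀ {U : Type u} (v : Valuation U),
        t'.eval ((sharedEnv st.shared).interp (Sym.eval v)) = x.eval v := by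
      intro U v
      rw [Term.eval_symEval, ht', Sym.eval_reflect]
    have henv : ∀ {U : Type u} (v : Valuation U) (o : T.Obj U),
        (sharedEnv ((st.fresh, T) :: st.shared)).interp
          (Sym.eval (v.set x.origin.1 st.fresh T o)) =
        (o, (sharedEnv st.shared).interp (Sym.eval v)) := by
      intro U v o
      refine Prod.ext ?_ (h.wf.shared_congr (hvw v o)).symm
      refine (Sym.eval_reflect _ _).trans ?_
      rw [hc]
      exact Valuation.set_self ..
    refine h.inseparable b ⟨.ex t' θ, fun U v hv => ?_, fun U v hv => ?_⟩
    · obtain ⟨o, ho, hw⟩ := hwit v hv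
      have := h₁ U _ hw
      rw [henv] at this
      exact ⟨o, by rwa [hval'], this⟩
    · rintro ⟨o, ho, hθ⟩
      rw [hval'] at ho
      refine h₂ U _ (Stage.models_addFact_not (h.wf.models_addMem hx.1 hv ho)) ?_
      rw [henv]
      exact hθ
  · have hsh : ((st.addMem x).addFact b
        (φ.at (Γ := T :: Γ) ((Neutral.root x.origin.1 st.fresh T).reflect T, σ))).shared =
          st.shared := if_neg (by simp [hc])
    unfold Stage.Separable at hs
    rw [hsh] at hs
    obtain ⟨θ, h₁, h₂⟩ := hs
    refine h.inseparable b ⟨θ, fun U v hv => ?_, fun U v hv => h₂ U v ?_⟩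
    · obtain ⟨o, ho, hw⟩ := hwit v hv
      have := h₁ U _ hw
      rwa [← h.wf.shared_congr (hvw v o)] at this
    · refine Stage.models_addFact_not ⟨hv.1, ?_⟩
      rintro m (rfl | hm) hc'
      · simp [hc] at hc'
      · exact hv.2 m hm hc'

/-- Every fact of the side `b` that is the existential statement `q` has a declared witness. -/
def Stage.Witnessed (st : Stage) (b : Bool) : Statement → Prop
  | ⟨⟨Γ, .ex (T := T) t φ⟩, σ⟩ => ∃ k, ⟨T, k, t.symEval σ⟩ ∈ st.mems ∧
      φ.at (Γ := T :: Γ)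
        ((Neutral.root (Neutral.origin (T := .set T) (t.symEval σ)).1 k T).reflect T, σ) ∈
        st.facts b
  | _ => True

/-- A good stage can be extended so that a given statement is decided and witnessed. -/
theorem Stage.Good.exists_decide {st : Stage} (h : Stage.Good.{u} st) (b : Bool) {Γ : Ctx}
    (φ : Formula Γ) (σ : SymEnv Γ) :
    ∃ st' : Stage, Stage.Good.{u} st' ∧ st.Le st' ∧ (σ.Over (st.Known b) →
      φ.at σ ∈ st'.facts b ∧ st'.Witnessed b (φ.at σ) ∨ φ.neg.at σ ∈ st'.facts b) := by
  by_cases hσ : σ.Over (st.Known b)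
  swap
  · exact ⟨st, h, Stage.Le.refl st, fun hσ' => (hσ hσ').elim⟩
  rcases h.addFact φ hσ with h' | h'
  · have hle := st.le_addFact b (φ.at σ)
    have hmem := st.mem_addFact b (φ.at σ)
    cases φ with
    | ex t φ =>
      have hg := h'.addWitness hmem (t.symEval σ) rfl
      have hle' := Stage.le_addMem (st.addFact b ((Formula.ex t φ).at σ))
        (T := _) (t.symEval σ)
      have hle'' := Stage.le_addFact
        ((st.addFact b ((Formula.ex t φ).at σ)).addMem (t.symEval σ)) b
        (φ.at (Γ := _ :: Γ) ((Neutral.root (Neutral.origin (T := .set _) (t.symEval σ)).1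
          (st.addFact b ((Formula.ex t φ).at σ)).fresh _).reflect _, σ))
      exact ⟨_, hg, hle.trans (hle'.trans hle''), fun _ =>
        Or.inl ⟨(hle'.trans hle'').facts b hmem, _, Or.inl rfl, Stage.mem_addFact _ _ _⟩⟩
    | _ => exact ⟨_, h', hle, fun _ => Or.inl ⟨hmem, trivial⟩⟩
  · exact ⟨_, h', st.le_addFact b _, fun _ => Or.inr (st.mem_addFact b _)⟩

/-! ### Limits of stages -/

/-- An increasing sequence of good stages in which every statement is eventually decided. -/
structure Saturated (s : ℕ → Stage) : Prop where
  good : ∀ k, Stage.Good.{u} (s k)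
  le : ∀ {j k}, j ≤ k → (s j).Le (s k)
  decide : ∀ (b : Bool) {Γ : Ctx} (φ : Formula Γ) (σ : SymEnv Γ) (j : ℕ),
    σ.Over ((s j).Known b) → ∃ k, j ≤ k ∧
      (φ.at σ ∈ (s k).facts b ∧ (s k).Witnessed b (φ.at σ) ∨ φ.neg.at σ ∈ (s k).facts b)

/-- The enumeration repeats every statement infinitely often, so a statement is treated again after
all of its names have come into use. -/
theorem Stage.Good.exists_saturated {st : Stage} (h : Stage.Good.{u} st) :
    ∃ s : ℕ → Stage, s 0 = st ∧ Saturated.{u} s := by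
  have : Nonempty (Bool × Statement) := ⟨(true, (Formula.top (Γ := [])).at PUnit.unit)⟩
  obtain ⟨e, he⟩ := exists_enumeration (Bool × Statement)
  have hstep : ∀ (st : {st // Stage.Good.{u} st}) (r : Bool × Statement),
      ∃ st' : {st // Stage.Good.{u} st}, st.1.Le st'.1 ∧ (r.2.2.Over (st.1.Known r.1) →
        r.2.1.2.at r.2.2 ∈ st'.1.facts r.1 ∧ st'.1.Witnessed r.1 (r.2.1.2.at r.2.2) ∨
          r.2.1.2.neg.at r.2.2 ∈ st'.1.facts r.1) := by
    rintro ⟨st, hst⟩ ⟨b, ⟨Γ, φ⟩, σ⟩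
    obtain ⟨st', h₁, h₂, h₃⟩ := hst.exists_decide b φ σ
    exact ⟨⟨st', h₁⟩, h₂, h₃⟩
  choose next hle hnext using hstep
  let s : ℕ → {st // Stage.Good.{u} st} := fun k => Nat.rec ⟨st, h⟩ (fun k st => next st (e k)) k
  have hs : ∀ k, (s k).1.Le (s (k + 1)).1 := fun k => hle (s k) (e k)
  have hmono : ∀ {j k}, j ≤ k → (s j).1.Le (s k).1 := by
    intro j k hjk
    induction k, hjk using Nat.le_induction with
    | base => exact Stage.Le.refl _
    | succ k _ ih => exact ih.trans (hs k)
  refine ⟨fun k => (s k).1, rfl, fun k => (s k).2, hmono, fun b Γ φ σ j hσ => ?_⟩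
  obtain ⟨k, hjk, hk⟩ := he (b, φ.at σ) j
  refine ⟨k + 1, by omega, ?_⟩
  have := hnext (s k) (e k)
  rw [hk] at this
  have hdec := this (hσ.mono fun r hr => (hmono hjk).known hr)
  have hsk : s (k + 1) = next (s k) (b, φ.at σ) := by rw [← hk]
  rw [hsk]
  exact hdec

namespace Saturated

variable {s : ℕ → Stage}

/-- A statement about names in use that follows from a stage is a fact of a later stage. -/
theorem mem_of_forced (hs : Saturated.{u} s) {b : Bool} {Γ : Ctx} {φ : Formula Γ}
    {σ : SymEnv Γ} {j : ℕ} (hσ : σ.Over ((s j).Known b))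
    (hforced : ∀ (U : Type u) (v : Valuation U), (s j).Models b v →
      φ.Holds (σ.interp (Sym.eval v))) :
    ∃ k, j ≤ k ∧ φ.at σ ∈ (s k).facts b ∧ (s k).Witnessed b (φ.at σ) := by
  obtain ⟨k, hjk, h | h⟩ := hs.decide b φ σ j hσ
  · exact ⟨k, hjk, h⟩
  · obtain ⟨U, v, hv⟩ := (hs.good k).exists_models b
    exact ((Formula.holds_neg _ _).1 (hv.1 _ h) (hforced U v ((hs.le hjk).models hv))).elim

/-- The neutrals of Ur-element type that are in use on the side `b` at some stage. -/
def Used (s : ℕ → Stage) (b : Bool) : Set (Neutral .ur) :=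
  {x | ∃ j, (s j).Known b x.origin}

/-- The equality of neutrals of Ur-element type that is forced by the side `b`. -/
def Same (s : ℕ → Stage) (b : Bool) (x y : Neutral .ur) : Prop :=
  ∃ j, ∀ (U : Type u) (v : Valuation U), (s j).Models b v → x.eval v = y.eval v

theorem same_equivalence (hs : Saturated.{u} s) (b : Bool) : Equivalence (Same.{u} s b) := by
  refine ⟨fun x => ⟨0, fun _ _ _ => rfl⟩, fun ⟨j, h⟩ => ⟨j, fun U v hv => (h U v hv).symm⟩, ?_⟩
  rintro x y z ⟨j, h⟩ ⟨k, h'⟩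
  refine ⟨max j k, fun U v hv => (h U v ?_).trans (h' U v ?_)⟩
  · exact (hs.le (le_max_left j k)).models hv
  · exact (hs.le (le_max_right j k)).models hv

/-- A neutral used on both sides comes from a shared name, as a private colour belongs to one side
only. If one side forced x = y and the other decided x ≠ y, the formula x = y in shared names would
separate a later stage. -/
theorem same_of_same (hs : Saturated.{u} s) {b c : Bool} {x y : Neutral .ur}
    (hx : x ∈ Used s true) (hx' : x ∈ Used s false) (hy : y ∈ Used s true)
    (hy' : y ∈ Used s false) (h : Same.{u} s b x y) : Same.{u} s c x y := by
  have shared : ∀ z : Neutral .ur, z ∈ Used s true → z ∈ Used s false →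
      z.origin.1 = none ∧ ∃ j, z.origin.2.1 < (s j).fresh ∧ z.origin.2 ∈ (s j).shared := by
    rintro z ⟨j, h₁, h₂⟩ ⟨k, h₃, h₄⟩
    rcases h₂ with h₂ | h₂
    · exact ⟨h₂.1, j, h₁, h₂.2⟩
    · rcases h₄ with h₄ | h₄
      · exact ⟨h₄.1, k, h₃, h₄.2⟩
      · simp [h₂] at h₄
  obtain ⟨hxc, i, hxi, hxi'⟩ := shared x hx hx'
  obtain ⟨hyc, j, hyj, hyj'⟩ := shared y hy hy'
  by_cases hbc : b = c
  · exact hbc ▸ h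
  have hc : c = !b := by cases b <;> cases c <;> simp_all
  obtain ⟨l, hl⟩ := h
  have hle₁ : (s i).Le (s (max i j)) := hs.le (le_max_left i j)
  have hle₂ : (s j).Le (s (max i j)) := hs.le (le_max_right i j)
  let φ : Formula [.ur, .ur] := .eq (.var .here) (.var (.there .here))
  let σ : SymEnv [.ur, .ur] := (x, y, PUnit.unit)
  have hσ : σ.Over ((s (max i j)).Known c) :=
    ⟨hle₁.known ⟨hxi, Or.inl ⟨hxc, hxi'⟩⟩, hle₂.known ⟨hyj, Or.inl ⟨hyc, hyj'⟩⟩, trivial⟩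
  obtain ⟨k, hk, h' | h'⟩ := hs.decide c φ σ _ hσ
  · exact ⟨k, fun U v hv => hv.1 _ h'.1⟩
  · exfalso
    have hm : (s (max i j)).Le (s (max k l)) := hs.le (hk.trans (le_max_left k l))
    obtain ⟨t, ht⟩ := exists_term_of_shared x hxc ((hle₁.trans hm).shared hxi')
    obtain ⟨t', ht'⟩ := exists_term_of_shared y hyc ((hle₂.trans hm).shared hyj')
    have htx : ∀ {U : Type u} (v : Valuation U),
        t.eval ((sharedEnv (s (max k l)).shared).interp (Sym.eval v)) = x.eval v := by
      intro U v
      rw [Term.eval_symEval, ht, Sym.eval_reflect]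
    have hty : ∀ {U : Type u} (v : Valuation U),
        t'.eval ((sharedEnv (s (max k l)).shared).interp (Sym.eval v)) = y.eval v := by
      intro U v
      rw [Term.eval_symEval, ht', Sym.eval_reflect]
    refine (hs.good (max k l)).inseparable b ⟨.eq t t', fun U v hv => ?_, fun U v hv => ?_⟩
    · simp only [Formula.Holds, htx, hty]
      exact hl U v ((hs.le (le_max_right k l)).models hv)
    · simp only [Formula.Holds, htx, hty]
      rw [← hc] at hv
      exact ((hs.le (le_max_left k l)).models hv).1 _ h'

end Saturated

/-- Amalgamation of two equivalence relations that agree on the intersection of two sets. -/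
theorem exists_amalgam {N : Type} (D : Bool → Set N) (E : Bool → N → N → Prop)
    (hE : ∀ b, Equivalence (E b))
    (hD : ∀ b c x y, x ∈ D true → x ∈ D false → y ∈ D true → y ∈ D false → E b x y → E c x y) :
    ∃ (U : Type u) (f : N → U), ∀ b, ∀ x ∈ D b, ∀ y ∈ D b, f x = f y ↔ E b x y := by
  classical
  -- the class of `x` on the side `b`, extended through the common elements
  let K : N → N → Prop := fun x y => ∃ b, x ∈ D b ∧ y ∈ D b ∧ E b x y
  -- Each `x` will be sent to the set of its `R`-relatives. It suffices that `R` implies `E b` on `D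
  -- b` (`hR`) and that these sets are invariant under `E b` (`hRE`), so `R` itself need not be
  -- shown to be an equivalence. One passage through a common element is enough, because the two
  -- relations agree on common elements.
  let R : N → N → Prop := fun x y => K x y ∨ ∃ z ∈ D true ∩ D false, K x z ∧ K z y
  have hside : ∀ {b x z}, x ∈ D b → z ∈ D true ∩ D false → K x z → E b x z := by
    rintro b x z hx hz ⟨c, hxc, hzc, h⟩
    by_cases hbc : c = b
    · exact hbc ▸ h
    · have hx' : x ∈ D true ∧ x ∈ D false := by cases b <;> cases c <;> simp_all
      exact hD c b x z hx'.1 hx'.2 hz.1 hz.2 h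
  have hK : ∀ {b x y}, x ∈ D b → y ∈ D b → K x y → E b x y := by
    rintro b x y hx hy ⟨c, hxc, hyc, h⟩
    by_cases hbc : c = b
    · exact hbc ▸ h
    · have hx' : x ∈ D true ∧ x ∈ D false := by cases b <;> cases c <;> simp_all
      have hy' : y ∈ D true ∧ y ∈ D false := by cases b <;> cases c <;> simp_all
      exact hD c b x y hx'.1 hx'.2 hy'.1 hy'.2 h
  have hKsymm : ∀ {x y}, K x y → K y x := fun ⟨b, hx, hy, h⟩ => ⟨b, hy, hx, (hE b).symm h⟩
  have hmem : ∀ {z}, z ∈ D true ∩ D false → ∀ b, z ∈ D b := by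
    intro z hz b
    cases b
    · exact hz.2
    · exact hz.1
  have hR : ∀ {b x y}, x ∈ D b → y ∈ D b → R x y → E b x y := by
    rintro b x y hx hy (h | ⟨z, hz, h₁, h₂⟩)
    · exact hK hx hy h
    · exact (hE b).trans (hside hx hz h₁) ((hE b).symm (hside hy hz (hKsymm h₂)))
  have hRE : ∀ {b x y z}, x ∈ D b → y ∈ D b → E b x y → R x z → R y z := by
    rintro b x y z hx hy h (⟨c, hxc, hzc, h'⟩ | ⟨w, hw, h₁, h₂⟩)
    · by_cases hbc : c = b
      · subst hbc
        exact Or.inl ⟨c, hy, hzc, (hE c).trans ((hE c).symm h) h'⟩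
      · have hx' : x ∈ D true ∩ D false := by cases b <;> cases c <;> simp_all
        exact Or.inr ⟨x, hx', ⟨b, hy, hx, (hE b).symm h⟩, c, hxc, hzc, h'⟩
    · exact Or.inr ⟨w, hw, ⟨b, hy, hmem hw b,
        (hE b).trans ((hE b).symm h) (hside hx hw h₁)⟩, h₂⟩
  refine ⟨ULift (Set N), fun x => ⟨{z | R x z}⟩, fun b x hx y hy => ⟨fun h => ?_, fun h => ?_⟩⟩
  · have h' : {z | R x z} = {z | R y z} := congrArg ULift.down h
    have hyy : y ∈ {z | R y z} := Or.inl ⟨b, hy, hy, (hE b).refl y⟩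
    rw [← h'] at hyy
    exact hR hx hy hyy
  · exact congrArg ULift.up (Set.ext fun z => ⟨hRE hx hy h, hRE hy hx ((hE b).symm h)⟩)

/-! ### The model -/

/-- The objects denoted by symbolic objects in the limit of a sequence of stages. -/
def collapse (s : ℕ → Stage) {U : Type u} (f : Neutral .ur → U) : (T : Ty) → Sym T → T.Obj U
  | .ur, x => f x
  | .unit, _ => PUnit.unit
  | .prod S T, x => (collapse s f S x.1, collapse s f T x.2)
  -- The elements are exactly the values of the declared names; these have the smaller type `T`, so
  -- the recursion is on types.
  | .set T, x => {o : T.Obj U | ∃ j k, ⟨T, k, x⟩ ∈ (s j).mems ∧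
      o = collapse s f T ((Neutral.root (Neutral.origin (T := .set T) x).1 k T).reflect T)}

/-- The truth lemma, by induction on the formula. Only the passage from facts to truth is needed:
each step finds later facts about subformulas, either forced by earlier facts or chosen by a
decision. -/
theorem Saturated.holds_collapse {s : ℕ → Stage} (hs : Saturated.{u} s) {U : Type u}
    {f : Neutral .ur → U}
    (hf : ∀ b, ∀ x ∈ Used s b, ∀ y ∈ Used s b, f x = f y ↔ Same.{u} s b x y)
    {Γ : Ctx} (φ : Formula Γ) (σ : SymEnv Γ) (b : Bool) (j : ℕ)
    (h : φ.at σ ∈ (s j).facts b) : φ.Holds (σ.interp (collapse s f)) := by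
  have hev : ∀ {Γ : Ctx} (σ : SymEnv Γ) {T : Ty} (t : Term Γ T),
      t.eval (σ.interp (collapse s f)) = collapse s f T (t.symEval σ) :=
    fun σ _ t => Term.eval_interp (fun _ _ _ _ => rfl) σ t
  have hover : ∀ {Γ : Ctx} {φ : Formula Γ} {σ : SymEnv Γ} {j : ℕ},
      φ.at σ ∈ (s j).facts b → σ.Over ((s j).Known b) :=
    fun h => (hs.good _).wf.facts b _ h
  induction φ generalizing j with
  | eq t t' =>
    simp only [Formula.Holds, hev]
    have hσ := hover h
    refine (hf b _ ⟨j, Term.over_symEval hσ t⟩ _ ⟨j, Term.over_symEval hσ t'⟩).2 ⟨j, ?_⟩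
    intro V v hv
    have := hv.1 _ h
    simp only [Statement.Holds, Formula.Holds, Term.eval_symEval] at this
    exact this
  | ne t t' =>
    simp only [Formula.Holds, hev]
    have hσ := hover h
    intro heq
    obtain ⟨k, hk⟩ := (hf b _ ⟨j, Term.over_symEval hσ t⟩ _ ⟨j, Term.over_symEval hσ t'⟩).1 heq
    obtain ⟨V, v, hv⟩ := (hs.good (max j k)).exists_models b
    have := ((hs.le (le_max_left j k)).models hv).1 _ h
    simp only [Statement.Holds, Formula.Holds, Term.eval_symEval] at this
    exact this (hk V v ((hs.le (le_max_right j k)).models hv))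
  | top => trivial
  | bot =>
    obtain ⟨V, v, hv⟩ := (hs.good j).exists_models b
    exact hv.1 _ h
  | or φ ψ hφ hψ =>
    obtain ⟨k, hjk, h' | h'⟩ := hs.decide b φ σ j (hover h)
    · exact Or.inl (hφ σ k h'.1)
    · obtain ⟨l, -, h'', -⟩ := hs.mem_of_forced (φ := ψ) (hover h') (fun V v hv =>
        (((hs.le hjk).models hv).1 _ h).resolve_left ((Formula.holds_neg _ _).1 (hv.1 _ h')))
      exact Or.inr (hψ σ l h'')
  | and φ ψ hφ hψ =>
    obtain ⟨k, -, hk, -⟩ := hs.mem_of_forced (φ := φ) (hover h) fun V v hv => (hv.1 _ h).1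
    obtain ⟨l, -, hl, -⟩ := hs.mem_of_forced (φ := ψ) (hover h) fun V v hv => (hv.1 _ h).2
    exact ⟨hφ σ k hk, hψ σ l hl⟩
  | @all Γ T t φ hφ =>
    simp only [Formula.Holds, hev]
    -- An element of the collapsed set is a declared name, at which the instance of `φ` is forced.
    -- If the other side introduced this name, the bound and hence the name are shared, so the side
    -- `b` may use it.
    rintro o ⟨i, k, hk, rfl⟩
    have hx : (s j).Known b (Neutral.origin (T := .set T) (t.symEval σ)) :=
      Term.over_symEval (hover h) t
    have hle₁ : (s i).Le (s (max i j)) := hs.le (le_max_left i j)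
    have hle₂ : (s j).Le (s (max i j)) := hs.le (le_max_right i j)
    obtain ⟨h₁, -, h₃⟩ := (hs.good i).wf.mems _ hk
    have hσ : SymEnv.Over (Γ := T :: Γ) ((s (max i j)).Known b)
        ((Neutral.root (Neutral.origin (T := .set T) (t.symEval σ)).1 k T).reflect T, σ) := by
      refine ⟨Neutral.over_reflect ⟨h₁.trans_le hle₁.fresh, ?_⟩,
        (hover h).mono fun r hr => hle₂.known hr⟩
      exact hx.2.imp (fun hc => ⟨hc.1, hle₁.shared (h₃ hc.1)⟩) id
    obtain ⟨l, -, hl, -⟩ := hs.mem_of_forced (φ := φ) hσ fun V v hv => by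
      refine (hle₂.models hv).1 _ h _ ?_
      rw [Term.eval_symEval, Sym.eval_reflect]
      exact (hle₁.models hv).2 _ hk (hx.2.imp (fun hc => hc.1) id)
    exact hφ _ l hl
  | @ex Γ T t φ hφ =>
    simp only [Formula.Holds, hev]
    obtain ⟨l, -, -, k, hk, hl⟩ := hs.mem_of_forced (hover h) fun V v hv => hv.1 _ h
    exact ⟨_, ⟨l, k, hk, rfl⟩, hφ _ l hl⟩

/-- The facts of the two sides of a good stage have a common model. -/
theorem Stage.Good.exists_interp {st : Stage} (h : Stage.Good.{u} st) :
    ∃ (U : Type u) (m : ∀ T : Ty, Sym T → T.Obj U),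
      ∀ b, ∀ q ∈ st.facts b, q.1.2.Holds (q.2.interp m) := by
  obtain ⟨s, rfl, hs⟩ := h.exists_saturated
  obtain ⟨U, f, hf⟩ := exists_amalgam.{u} (Saturated.Used s) (Saturated.Same.{u} s)
    hs.same_equivalence fun b c x y => hs.same_of_same
  exact ⟨U, collapse s f, fun b q hq => hs.holds_collapse hf q.1.2 q.2 b 0 hq⟩

/-! ### Interpolation -/

theorem nonempty_valuation (U : Type u) [Nonempty U] : Nonempty (Valuation U) := by
  have key : ∀ T : Ty, Nonempty (T.Obj U) := by
    intro T
    induction T with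
    | ur => assumption
    | unit => exact ⟨PUnit.unit⟩
    | prod S T hS hT => exact ⟨(hS.some, hT.some)⟩
    | set T _ => exact ⟨(∅ : Set (T.Obj U))⟩
  exact ⟨fun _ _ T => (key T).some⟩

/-- Interpolation for the functionality of a formula: if all outputs allowed by `φ` agree with all
outputs allowed by `χ`, then `φ` can be replaced by a formula without auxiliary parameters. -/
theorem exists_interpolant {S T : Ty} {A B : Ctx} (φ : Formula (S :: T :: A))
    (χ : Formula (S :: T :: B))
    (h : ∀ (U : Type u) (i : S.Obj U) (o o' : T.Obj U) (a : Env U A) (b : Env U B),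
      φ.Holds (i, o, a) → χ.Holds (i, o', b) → o = o') :
    ∃ θ : Formula [S, T],
      (∀ (U : Type u) (i : S.Obj U) (o : T.Obj U) (a : Env U A),
        φ.Holds (i, o, a) → θ.Holds (i, o, PUnit.unit)) ∧
      ∀ (U : Type u) (i : S.Obj U) (o o' : T.Obj U) (b : Env U B),
        θ.Holds (i, o, PUnit.unit) → χ.Holds (i, o', b) → o = o' := by
  -- The input and the first output are shared. The parameters `A` belong to the side `true`; the
  -- second output and `B` belong to the side `false`, which also asserts that the outputs differ.
  -- Both parameter lists start at index 3, kept apart by colour.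
  let xi : Sym S := (Neutral.root none 0 S).reflect S
  let xo : Sym T := (Neutral.root none 1 T).reflect T
  let xo' : Sym T := (Neutral.root (some false) 2 T).reflect T
  let xa : SymEnv A := Ctx.names (some true) 3 A
  let xb : SymEnv B := Ctx.names (some false) 3 B
  let ne : Formula [T, T] := (Formula.equal T (.var .here) (.var (.there .here))).neg
  let q₁ : Statement := φ.at (Γ := S :: T :: A) (xi, xo, xa)
  let q₂ : Statement := χ.at (Γ := S :: T :: B) (xi, xo', xb)
  let q₃ : Statement := ne.at (Γ := [T, T]) (xo, xo', PUnit.unit)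
  let st : Stage :=
    { fresh := 3 + A.length + B.length
      shared := [(0, S), (1, T)]
      facts := fun b => if b then {q₁} else {q₂, q₃}
      mems := ∅ }
  have hi : ∀ b, Sym.Over (st.Known b) S xi := fun b =>
    Neutral.over_reflect ⟨by simp only [st, Neutral.origin]; omega,
      Or.inl ⟨rfl, by simp [st, Neutral.origin]⟩⟩
  have ho : ∀ b, Sym.Over (st.Known b) T xo := fun b =>
    Neutral.over_reflect ⟨by simp only [st, Neutral.origin]; omega,
      Or.inl ⟨rfl, by simp [st, Neutral.origin]⟩⟩
  have ho' : Sym.Over (st.Known false) T xo' :=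
    Neutral.over_reflect ⟨by simp only [st, Neutral.origin]; omega, Or.inr rfl⟩
  have hwf : st.WF := by
    refine ⟨fun b q hq => ?_, fun m hm => hm.elim, fun p hp => ?_⟩
    · cases b
      · rcases hq with rfl | rfl
        · exact ⟨hi _, ho', Ctx.names_over fun j _ _ hj =>
            ⟨by simp only [st]; omega, Or.inr rfl⟩⟩
        · exact ⟨ho _, ho', trivial⟩
      · obtain rfl : q = q₁ := hq
        exact ⟨hi _, ho _, Ctx.names_over fun j _ _ hj =>
          ⟨by simp only [st]; omega, Or.inr rfl⟩⟩
    · simp only [st, List.mem_cons, List.not_mem_nil, or_false] at hp ⊢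
      rcases hp with rfl | rfl <;> simp only <;> omega
  -- a valuation with prescribed values of the names in use
  have hval : ∀ (U : Type u) [Nonempty U] (i : S.Obj U) (o o' : T.Obj U) (c : Bool) (Γ : Ctx)
      (ρ : Env U Γ), ∃ v : Valuation U, Sym.eval v S xi = i ∧ Sym.eval v T xo = o ∧
        Sym.eval v T xo' = o' ∧ (Ctx.names (some c) 3 Γ).interp (Sym.eval v) = ρ := by
    intro U _ i o o' c Γ ρ
    obtain ⟨v⟩ := nonempty_valuation U
    obtain ⟨w, hw, hw'⟩ := Valuation.exists_interp_names
      (((v.set none 0 S i).set none 1 T o).set (some false) 2 T o') (some c) 3 ρ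
    refine ⟨w, ?_, ?_, ?_, hw⟩
    · refine (Sym.eval_reflect _ _).trans ((hw' _ _ _ (by simp)).trans ?_)
      rw [Valuation.set_of_ne _ _ (by simp), Valuation.set_of_ne _ _ (by simp),
        Valuation.set_self]
    · refine (Sym.eval_reflect _ _).trans ((hw' _ _ _ (by simp)).trans ?_)
      rw [Valuation.set_of_ne _ _ (by simp), Valuation.set_self]
    · refine (Sym.eval_reflect _ _).trans ((hw' _ _ _ (by simp)).trans ?_)
      rw [Valuation.set_self]
  -- A separating formula is an interpolant, because the side `false` contains o ≠ o'. Otherwise the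
  -- stage is good, and a common model of the two sides contradicts `h`.
  by_cases hsep : Stage.Separable.{u} st true
  · obtain ⟨θ, h₁, h₂⟩ := hsep
    have hne₁ : ∀ (U : Type u) [Nonempty U] (i : S.Obj U) (o : T.Obj U) (a : Env U A),
        φ.Holds (i, o, a) → Formula.Holds (Γ := [S, T]) θ (i, o, PUnit.unit) := by
      intro U _ i o a hφ
      obtain ⟨v, rfl, rfl, -, rfl⟩ := hval U i o o true A a
      refine h₁ U v ⟨fun q hq => ?_, fun m hm => hm.elim⟩
      obtain rfl : q = q₁ := hq
      exact hφ
    have hne₂ : ∀ (U : Type u) [Nonempty U] (i : S.Obj U) (o o' : T.Obj U) (b : Env U B),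
        Formula.Holds (Γ := [S, T]) θ (i, o, PUnit.unit) → χ.Holds (i, o', b) → o = o' := by
      intro U _ i o o' b hθ hχ
      obtain ⟨v, rfl, rfl, rfl, rfl⟩ := hval U i o o' false B b
      by_contra hne
      refine h₂ U v ⟨fun q hq => ?_, fun m hm => hm.elim⟩ hθ
      rcases hq with rfl | rfl
      · exact hχ
      · exact (Formula.holds_neg _ _).2 fun heq => hne ((Formula.holds_equal _ _ _ _).1 heq)
    -- A valuation gives a value to every name of every type, so none exists over an empty universe.
    -- That case is covered by moving from `U` to `Option U`.
    have hinj : ∀ U : Type u, Function.Injective (some : U → Option U) :=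
      fun U => Option.some_injective U
    refine ⟨θ, fun U i o a hφ => ?_, fun U i o o' b hθ hχ => ?_⟩
    · exact (Formula.holds_map (hinj U) _ _).1
        (hne₁ (Option U) _ _ _ ((Formula.holds_map (hinj U) φ (i, o, a)).2 hφ))
    · exact Ty.map_injective (hinj U) T (hne₂ (Option U) _ _ _ _
        ((Formula.holds_map (hinj U) (Γ := [S, T]) θ (i, o, PUnit.unit)).2 hθ)
        ((Formula.holds_map (hinj U) χ (i, o', b)).2 hχ))
  · obtain ⟨U, m, hm⟩ := Stage.Good.exists_interp.{u} (st := st)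
      ⟨hwf, fun _ hs => hsep hs.of_side⟩
    have h₁ := hm true q₁ rfl
    have h₂ := hm false q₂ (Or.inl rfl)
    have h₃ := hm false q₃ (Or.inr rfl)
    refine ((Formula.holds_neg _ _).1 h₃ ((Formula.holds_equal _ _ _ _).2 ?_)).elim
    exact h U _ _ _ _ _ h₁ h₂

end NestedRel

/-! ### The theorem, by two interpolations. -/

theorem mainTheorem9 (S T : NestedRel.Ty) (A : NestedRel.Ctx)
    (φ : NestedRel.Formula (S :: T :: A)) (hφ : NestedRel.ImplicitlyDefines.{u} φ) :
    ∃ ψ : NestedRel.Formula [S, T],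
      NestedRel.ImplicitlyDefines.{u} ψ ∧
      ∀ (U : Type u) (i : S.Obj U) (o : T.Obj U) (a : NestedRel.Env U A),
        φ.Holds (i, o, a) → ψ.Holds (i, o, PUnit.unit) := by
  obtain ⟨θ₁, h₁, h₁'⟩ := NestedRel.exists_interpolant.{u} φ φ hφ
  obtain ⟨θ₂, h₂, h₂'⟩ := NestedRel.exists_interpolant.{u} φ θ₁
    fun U i o o' a _ h h' => (h₁' U i o' o a h' h).symm
  -- Outputs of `θ₂` agree with outputs of `θ₁`, so one binding contributes its `θ₂` half and the
  -- other its `θ₁` half.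
  exact ⟨.and θ₁ θ₂, fun U i o o' a a' h h' => h₂' U i o o' PUnit.unit h.2 h'.1,
    fun U i o a h => ⟨h₁ U i o a h, h₂ U i o a h⟩⟩
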